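/- Theorem 1 (existence of an equilibrium). Let $\mathcal N=\{1,\dots,N\}$ be a set of clients. Client $n$ has a data capacity $D_n\ge 0$, a label noise rate $\epsilon_n\in[0,1]$ and a privacy sensitivity $\mu_n\ge 0$, and chooses a data contribution $s_n\in[0,D_n]$. Write $\boldsymbol s=(s_n)_{n}$, $\boldsymbol\epsilon=(\epsilon_n)_n$ and $S=\prod_n[0,D_n]$. Let $A(\boldsymbol s,\boldsymbol\epsilon)\in\mathbb R$ be the accuracy of the global model, $\Pi$ a total profit function that is non-decreasing in the accuracy, $I_n(\boldsymbol s,\boldsymbol\epsilon)$ real contribution indices with $\sum_{m}I_m(\boldsymbol s,\boldsymbol\epsilon)\ne 0$ on $S$, $g_n=I_n/\sum_{m}I_m$ the profit share of client $n$, and $C_n^{\rm pri}(s_n)=\mu_n f(s_n)$ its privacy cost. The payoff of client $n$ is $$U_n(\boldsymbol s,\boldsymbol\epsilon)=g_n(\boldsymbol s,\boldsymbol\epsilon)\,\Pi(A(\boldsymbol s,\boldsymbol\epsilon))-C_n^{\rm pri}(s_n).$$ For the given $\boldsymbol\epsilon$, suppose that $A(\cdot,\boldsymbol\epsilon)$ and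 all $g_n(\cdot,\boldsymbol\epsilon)$ are continuous on $S$, that $\Pi$ is continuous on the set of accuracies attained on $S$, and that each $C_n^{\rm pri}$ is continuous on $[0,D_n]$. Suppose further that: 1. for every $n$ and every fixed choice of the other contributions, $A$ is concave and non-decreasing in $s_n\in[0,D_n]$; 2. for every $n$, the allocated profit $g_n\cdot\Pi(A)$ is concave in $s_n\in[0,D_n]$ for every fixed choice of the other contributions; or, alternatively, for every fixed choice of the other contributions, $g_n$ and $\Pi(A(\boldsymbol s,\boldsymbol\epsilon))$ are twice differentiable in $s_n\in(0,D_n)$ and $$\frac{\partial^2 g_n}{\partial s_n^2}\,\Pi(A)+2\,\frac{\partial g_n}{\partial s_n}\,\frac{\partial\, \Pi(A)}{\partial s_n}+g_n\,\frac{\partial^2\, \Pi(A)}{\partial s_n^2}\le 0 ;$$ 3. for every $n$, $C_n^{\rm pri}$ is convex and non-decreasing on $[0,D_n]$. Then the data contribution game, with players $\mathcal N$, strategy sets $[0,D_n]$ and payoffs $U_n$, has a pure-strategy Nash equilibrium: there is $\boldsymbol s^*\in S$ such that $U_n(s_n^*,\boldsymbol s_{-n}^*,\boldsymbol\epsilon)\ge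 U_n(s_n',\boldsymbol s_{-n}^*,\boldsymbol\epsilon)$ for all $n\in\mathcal N$ and all $s_n'\in[0,D_n]$. -/

import Mathlib

open Set

/-- The data of a data contribution game with `N` clients: capacities `D n`, label noise
rates `noise n`, privacy sensitivities `μ n`, the global model accuracy `A (s, ε)`, the profit
function `Π`, the contribution indices `I n (s, ε)` of the profit allocation mechanism, and the
function `f` in the privacy cost `μ n * f (s n)`. -/
structure DataContributionGame (N : ℕ) where
  capacity : Fin N → ℝ
  capacity_nonneg : ∀ n, 0 ≤ capacity n
  noise : Fin N → ℝ
  noise_mem : ∀ n, noise n ∈ Icc (0 : ℝ) 1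
  sensitivity : Fin N → ℝ
  sensitivity_nonneg : ∀ n, 0 ≤ sensitivity n
  accuracy : (Fin N → ℝ) → (Fin N → ℝ) → ℝ
  profit : ℝ → ℝ
  index : Fin N → (Fin N → ℝ) → (Fin N → ℝ) → ℝ
  leakage : ℝ → ℝ

namespace DataContributionGame

variable {N : ℕ}

/-- The strategy set `[0, D n]` of client `n`. -/
def strategies (G : DataContributionGame N) (n : Fin N) : Set ℝ := Icc 0 (G.capacity n)

/-- The set of strategy profiles, the product of the intervals `[0, D n]`. -/
def profiles (G : DataContributionGame N) : Set (Fin N → ℝ) := {s | ∀ n, s n ∈ G.strategies n}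

/-- The accuracy `A (s, ε)` as a function of the profile `s`, at the given noise rates. -/
def acc (G : DataContributionGame N) (s : Fin N → ℝ) : ℝ := G.accuracy s G.noise

/-- The total profit `Π (A (s, ε))`. -/
def totalProfit (G : DataContributionGame N) (s : Fin N → ℝ) : ℝ := G.profit (G.acc s)

/-- The profit share `g n = I n / ∑ m, I m`. -/
noncomputable def share (G : DataContributionGame N) (n : Fin N) (s : Fin N → ℝ) : ℝ :=
  G.index n s G.noise / ∑ m, G.index m s G.noise

/-- The allocated profit `g n * Π (A)` of client `n`. -/
noncomputable def allocatedProfit (G : DataContributionGame N) (n : Fin N) (s : Fin N → ℝ) : ℝ :=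
  G.share n s * G.totalProfit s

/-- The privacy cost `μ n * f (x)` of client `n` at contribution level `x`. -/
def privacyCost (G : DataContributionGame N) (n : Fin N) (x : ℝ) : ℝ :=
  G.sensitivity n * G.leakage x

/-- The payoff of client `n`: allocated profit minus privacy cost. -/
noncomputable def payoff (G : DataContributionGame N) (n : Fin N) (s : Fin N → ℝ) : ℝ :=
  G.allocatedProfit n s - G.privacyCost n (s n)

/-- Pure-strategy Nash equilibria: feasible profiles at which no client gains by deviating
unilaterally within its own strategy set. -/
def IsNashEquilibrium (G : DataContributionGame N) (s : Fin N → ℝ) : Prop :=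
  s ∈ G.profiles ∧
    ∀ n, ∀ x ∈ G.strategies n, G.payoff n (Function.update s n x) ≤ G.payoff n s

/-- Standing conventions of the model: the profit is non-decreasing in the accuracy, the quotients
that define the profit shares have non-zero denominators, and the functions of the model are
continuous. All of this is required on the strategy sets only. -/
structure IsRegular (G : DataContributionGame N) : Prop where
  profit_mono : MonotoneOn G.profit (G.acc '' G.profiles)
  index_sum_ne_zero : ∀ s ∈ G.profiles, ∑ m, G.index m s G.noise ≠ 0
  continuousOn_acc : ContinuousOn G.acc G.profiles
  continuousOn_profit : ContinuousOn G.profit (G.acc '' G.profiles)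
  continuousOn_share : ∀ n, ContinuousOn (G.share n) G.profiles
  continuousOn_privacyCost : ∀ n, ContinuousOn (G.privacyCost n) (G.strategies n)

/-- The accuracy is concave and increasing in each single `s n`. -/
def AccuracyConcaveIncreasing (G : DataContributionGame N) : Prop :=
  ∀ n, ∀ s ∈ G.profiles,
    ConcaveOn ℝ (G.strategies n) (fun x => G.acc (Function.update s n x)) ∧
    MonotoneOn (fun x => G.acc (Function.update s n x)) (G.strategies n)

/-- The allocated profit of client `n` is concave in its own contribution. -/
def AllocatedProfitConcave (G : DataContributionGame N) (n : Fin N) : Prop :=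
  ∀ s ∈ G.profiles,
    ConcaveOn ℝ (G.strategies n) (fun x => G.allocatedProfit n (Function.update s n x))

/-- The second-derivative condition: along `s n`, in the interior of the strategy set, the share
`g n` and the total profit `P = Π (A)` are twice differentiable and
`g'' * P + 2 * g' * P' + g * P'' ≤ 0`, where the primes are derivatives with respect to `s n`. -/
def SecondDerivativeCondition (G : DataContributionGame N) (n : Fin N) : Prop :=
  ∀ s ∈ G.profiles,
    let g : ℝ → ℝ := fun x => G.share n (Function.update s n x)
    let P : ℝ → ℝ := fun x => G.totalProfit (Function.update s n x)
    ∀ x ∈ Ioo 0 (G.capacity n),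
      DifferentiableAt ℝ g x ∧ DifferentiableAt ℝ (deriv g) x ∧
      DifferentiableAt ℝ P x ∧ DifferentiableAt ℝ (deriv P) x ∧
      deriv (deriv g) x * P x + 2 * deriv g x * deriv P x + g x * deriv (deriv P) x ≤ 0

/-- The privacy cost of every client is convex and increasing in its own contribution. -/
def PrivacyCostConvexIncreasing (G : DataContributionGame N) : Prop :=
  ∀ n, ConvexOn ℝ (G.strategies n) (G.privacyCost n) ∧
    MonotoneOn (G.privacyCost n) (G.strategies n)

end DataContributionGame

/-! The payoffs are continuous, and each is concave in the player's own contribution, so the claim is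
the existence theorem for concave games (`exists_equilibrium_of_quasiconcaveOn`). Since the strategy
sets are intervals, fixed points of correspondences can be avoided. For each player `i` consider the
closed set of profiles at which some best response of `i` is at least `s i`, and the closed set of
those at which some best response is at most `s i`. Together they cover the box of profiles, the
first contains the face where `s i` is minimal and the second the opposite face. By the covering form
of the Poincaré–Miranda theorem (`exists_mem_of_closed_cover`), some profile lies in all these sets;
there `s i` lies between two best responses, and is one itself by quasiconcavity.

The covering theorem follows by compactness from a combinatorial lemma of Kuhn on `0`-`1` labels
`f i` of a cubical grid (`CubicalCochain.exists_cube_all_labels`): if `f i` is `0` on one face and `1`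
on the opposite face in the direction `i`, then some unit cube carries both values of each `f i`. Its
proof is a computation in cubical cochains modulo two. The cup product of the coboundaries of all
`f i` is nonzero only on such cubes. It is the coboundary of the cup product of one of the `f i` with
the coboundaries of the others, so by Stokes' formula its sum over the grid is a sum over boundary
faces. All of these vanish but one, which is the same sum in one dimension less; hence the total is
`1` (`CubicalCochain.sum_cupCoboundaries`).

The second-derivative condition says that the second derivative of the allocated profit is nonpositive
in the interior, so by continuity up to the end points it implies concavity. -/

/-! ### Cubical cochains modulo two -/

namespace CubicalCochain

variable {ι : Type*} [DecidableEq ι]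

/-- The vertex of the unit cube at `q` that is one step away from `q` in the directions `S`. -/
def corner (q : ι → ℕ) (S : Finset ι) : ι → ℕ := fun i => if i ∈ S then q i + 1 else q i

theorem corner_corner_erase (q : ι → ℕ) {S : Finset ι} {i : ι} (hi : i ∈ S) :
    corner (corner q {i}) (S.erase i) = corner q S := by
  funext j
  by_cases h : j = i
  · subst h; simp [corner, hi]
  · simp [corner, h]

theorem corner_singleton_comm (q : ι → ℕ) (i j : ι) :
    corner (corner q {i}) {j} = corner (corner q {j}) {i} := by
  funext l
  simp only [corner, Finset.mem_singleton]
  split_ifs <;> rfl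

theorem corner_apply_of_notMem (q : ι → ℕ) {S : Finset ι} {i : ι} (hi : i ∉ S) :
    corner q S i = q i := by
  simp [corner, hi]

/-- The cubical coboundary modulo two. A cochain assigns a value to each cube of the lattice, given
by its lowest vertex `q` and the finite set `S` of its edge directions; the coboundary adds the
values on the two faces in each direction. -/
def coboundary (c : (ι → ℕ) → Finset ι → ZMod 2) (q : ι → ℕ) (S : Finset ι) : ZMod 2 :=
  ∑ i ∈ S, (c (corner q {i}) (S.erase i) + c q (S.erase i))

theorem coboundary_coboundary (c : (ι → ℕ) → Finset ι → ZMod 2) (q : ι → ℕ) (S : Finset ι) :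
    coboundary (coboundary c) q S = 0 := by
  simp only [coboundary, ← Finset.sum_add_distrib]
  rw [Finset.sum_sigma']
  -- the terms of `(i, j)` and `(j, i)` agree, so they cancel modulo two
  refine Finset.sum_involution (fun p _ => ⟨p.2, p.1⟩) ?_ ?_ ?_ ?_
  · rintro ⟨i, j⟩ -
    simp only
    rw [corner_singleton_comm q i j, Finset.erase_right_comm (a := i) (b := j)]
    generalize c (corner (corner q {j}) {i}) _ = w
    generalize c (corner q {i}) _ = x
    generalize c (corner q {j}) _ = y
    generalize c q _ = z
    linear_combination CharTwo.add_self_eq_zero (w + x + y + z)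
  · rintro ⟨i, j⟩ h - e
    simp only [Finset.mem_sigma, Finset.mem_erase] at h
    exact h.2.1 (congrArg Sigma.fst e)
  · rintro ⟨i, j⟩ h
    simp only [Finset.mem_sigma, Finset.mem_erase] at h ⊢
    exact ⟨h.2.2, h.2.1.symm, h.1⟩
  · rintro ⟨i, j⟩ -
    rfl

/-- The cup product of the coboundaries of the vertex functions `f i`, for `i` in the list `l` read
from its end. On the cube `(q, S)` it is the sum, over the monotone edge paths from `q` to the
opposite vertex, of the products of the increments of the `f i` along the successive edges. -/
def cupCoboundaries (f : ι → (ι → ℕ) → ZMod 2) : List ι → (ι → ℕ) → Finset ι → ZMod 2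
  | [], _, _ => 1
  | i :: l, q, S =>
    ∑ j ∈ S, cupCoboundaries f l q (S.erase j) * (f i (corner q S) + f i (corner q (S.erase j)))

/-- The cup product of the cochain `c` with the vertex function `f`. -/
def cupVertex (c : (ι → ℕ) → Finset ι → ZMod 2) (f : (ι → ℕ) → ZMod 2)
    (q : ι → ℕ) (S : Finset ι) : ZMod 2 :=
  c q S * f (corner q S)

/-- The Leibniz rule for the coboundary, for a cocycle `c` and a vertex function. -/
theorem coboundary_cupVertex {c : (ι → ℕ) → Finset ι → ZMod 2}
    (hc : ∀ q S, coboundary c q S = 0) (f : (ι → ℕ) → ZMod 2) (q : ι → ℕ) (S : Finset ι) :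
    coboundary (cupVertex c f) q S =
      ∑ j ∈ S, c q (S.erase j) * (f (corner q S) + f (corner q (S.erase j))) := by
  have h : (∑ i ∈ S, (c (corner q {i}) (S.erase i) + c q (S.erase i))) * f (corner q S) = 0 := by
    rw [← coboundary, hc, zero_mul]
  rw [Finset.sum_mul] at h
  rw [← sub_eq_zero, ← h, coboundary, ← Finset.sum_sub_distrib]
  refine Finset.sum_congr rfl fun i hi => ?_
  simp only [cupVertex, corner_corner_erase q hi]
  linear_combination -CharTwo.add_self_eq_zero (c q (S.erase i) * f (corner q S))

theorem coboundary_cupCoboundaries (f : ι → (ι → ℕ) → ZMod 2) (l : List ι) :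
    ∀ q S, coboundary (cupCoboundaries f l) q S = 0 := by
  induction l with
  | nil => intro q S; simp [coboundary, cupCoboundaries, CharTwo.add_self_eq_zero]
  | cons i l ih =>
    have h : cupCoboundaries f (i :: l) = coboundary (cupVertex (cupCoboundaries f l) (f i)) := by
      funext q S
      rw [coboundary_cupVertex ih, cupCoboundaries]
    rw [h]
    exact coboundary_coboundary _

theorem exists_ne_of_cupCoboundaries_ne_zero (f : ι → (ι → ℕ) → ZMod 2) (q : ι → ℕ) :
    ∀ (l : List ι) (S : Finset ι), cupCoboundaries f l q S ≠ 0 → ∀ i ∈ l,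
      ∃ T ⊆ S, ∃ T' ⊆ S, f i (corner q T) ≠ f i (corner q T') := by
  intro l
  induction l with
  | nil => simp
  | cons j l ih =>
    intro S h i hi
    obtain ⟨a, ha, hne⟩ := Finset.exists_ne_zero_of_sum_ne_zero h
    rcases List.mem_cons.1 hi with rfl | hi
    · refine ⟨S, subset_rfl, S.erase a, Finset.erase_subset _ _, fun e => hne ?_⟩
      rw [e, CharTwo.add_self_eq_zero, mul_zero]
    · obtain ⟨T, hT, T', hT', e⟩ := ih (S.erase a) (left_ne_zero_of_mul hne) i hi
      exact ⟨T, hT.trans (Finset.erase_subset _ _), T', hT'.trans (Finset.erase_subset _ _), e⟩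

theorem cupCoboundaries_eq_zero_of_face {f : ι → (ι → ℕ) → ZMod 2} {l : List ι} {i : ι}
    (hi : i ∈ l) {q : ι → ℕ} {S : Finset ι} (hS : i ∉ S) {z : ZMod 2}
    (hf : ∀ v : ι → ℕ, v i = q i → f i v = z) : cupCoboundaries f l q S = 0 := by
  by_contra h
  obtain ⟨T, hT, T', hT', e⟩ := exists_ne_of_cupCoboundaries_ne_zero f q l S h i hi
  apply e
  rw [hf _ (corner_apply_of_notMem q fun h => hS (hT h)),
    hf _ (corner_apply_of_notMem q fun h => hS (hT' h))]

theorem sum_piFinset_eq_sum_sum_update [Fintype ι] {α M : Type*} [AddCommMonoid M]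
    (A : ι → Finset α) (i : ι) (c : α) (h : (ι → α) → M) :
    ∑ q ∈ Fintype.piFinset A, h q =
      ∑ q ∈ Fintype.piFinset (Function.update A i {c}),
        ∑ t ∈ A i, h (Function.update q i t) := by
  rw [Finset.sum_sigma']
  refine Finset.sum_bij' (fun q _ => ⟨Function.update q i c, q i⟩)
    (fun p _ => Function.update p.1 i p.2) ?_ ?_ ?_ ?_ ?_
  · intro q hq
    rw [Fintype.mem_piFinset] at hq
    simp only [Finset.mem_sigma, Fintype.mem_piFinset]
    refine ⟨fun j => ?_, hq i⟩
    rcases eq_or_ne j i with rfl | hj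
    · simp
    · simp [hj, hq j]
  · rintro ⟨q, t⟩ hq
    simp only [Finset.mem_sigma, Fintype.mem_piFinset] at hq ⊢
    intro j
    rcases eq_or_ne j i with rfl | hj
    · simpa using hq.2
    · simpa [hj] using hq.1 j
  · intro q _
    simp
  · rintro ⟨q, t⟩ hq
    simp only [Finset.mem_sigma, Fintype.mem_piFinset] at hq
    have : q i = c := by simpa using hq.1 i
    subst this
    simp
  · intro q _
    simp

/-- Stokes' formula in a single direction: over a box of the lattice, the values on the two faces of
the unit cubes in the direction `i` telescope. -/
theorem sum_piFinset_add_corner [Fintype ι] (A : ι → Finset ℕ) (i : ι) {k : ℕ}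
    (hA : A i = Finset.range k) (c : ℕ) (g : (ι → ℕ) → ZMod 2) :
    ∑ q ∈ Fintype.piFinset A, (g (corner q {i}) + g q) =
      ∑ q ∈ Fintype.piFinset (Function.update A i {c}),
        (g (Function.update q i k) + g (Function.update q i 0)) := by
  rw [sum_piFinset_eq_sum_sum_update A i c, hA]
  refine Finset.sum_congr rfl fun q _ => ?_
  have h : ∀ t, corner (Function.update q i t) {i} = Function.update q i (t + 1) := by
    intro t
    funext j
    rcases eq_or_ne j i with rfl | hj <;> simp [corner, *]
  simp only [h, ← CharTwo.sub_eq_add]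
  exact Finset.sum_range_sub (fun t => g (Function.update q i t)) k

/-- The cup product sums to one over the unit cubes of a grid that has side `k` in the directions of
the list and is pinned to `k` in the others. By Stokes' formula the sum equals a sum over the boundary
of the grid, where only the face `v i = k` for the head `i` of the list contributes. -/
theorem sum_cupCoboundaries [Fintype ι] {f : ι → (ι → ℕ) → ZMod 2} {k : ℕ}
    (h0 : ∀ i v, v i = 0 → f i v = 0) (hk : ∀ i v, v i = k → f i v = 1)
    (l : List ι) (hl : l.Nodup) :
    ∑ q ∈ Fintype.piFinset (fun i => if i ∈ l then Finset.range k else {k}),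
      cupCoboundaries f l q l.toFinset = 1 := by
  induction l with
  | nil => simp [cupCoboundaries]
  | cons a l ih =>
    obtain ⟨hal, hl⟩ := List.nodup_cons.1 hl
    have hcob : ∀ q S, cupCoboundaries f (a :: l) q S =
        coboundary (cupVertex (cupCoboundaries f l) (f a)) q S := by
      intro q S
      rw [coboundary_cupVertex (coboundary_cupCoboundaries f l), cupCoboundaries]
    simp only [hcob, coboundary]
    rw [Finset.sum_comm, Finset.sum_eq_single a]
    · rw [sum_piFinset_add_corner (k := k) _ a (by simp) k fun q =>
        cupVertex (cupCoboundaries f l) (f a) q ((a :: l).toFinset.erase a)]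
      have hS : (a :: l).toFinset.erase a = l.toFinset := by
        simp [hal]
      have hbox : Function.update (fun i => if i ∈ a :: l then Finset.range k else {k}) a {k} =
          fun i => if i ∈ l then Finset.range k else {k} := by
        funext j
        rcases eq_or_ne j a with rfl | hj <;> simp [*]
      rw [hS, hbox, ← ih hl]
      refine Finset.sum_congr rfl fun q hq => ?_
      have ha : a ∉ l.toFinset := by simpa using hal
      have hqa : q a = k := by simpa [hal] using Fintype.mem_piFinset.1 hq a
      rw [cupVertex, cupVertex, hk a _ (by rw [corner_apply_of_notMem _ ha]; simp),
        h0 a _ (by rw [corner_apply_of_notMem _ ha]; simp), mul_zero, add_zero, mul_one, ← hqa,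
        Function.update_eq_self]
    · intro i hi hia
      have hil : i ∈ l := by simpa [hia] using hi
      rw [sum_piFinset_add_corner (k := k) _ i (by simp [hil]) k fun q =>
        cupVertex (cupCoboundaries f l) (f a) q ((a :: l).toFinset.erase i)]
      refine Finset.sum_eq_zero fun q _ => ?_
      -- `f i` is constant on both faces, so its coboundary vanishes there
      rw [cupVertex, cupVertex,
        cupCoboundaries_eq_zero_of_face hil (Finset.notMem_erase _ _)
          fun v hv => hk i v (by simpa using hv),
        cupCoboundaries_eq_zero_of_face hil (Finset.notMem_erase _ _)
          fun v hv => h0 i v (by simpa using hv)]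
      simp
    · simp

/-- Kuhn's cubical form of Sperner's lemma. -/
theorem exists_cube_all_labels [Fintype ι] {f : ι → (ι → ℕ) → ZMod 2} {k : ℕ}
    (h0 : ∀ i v, v i = 0 → f i v = 0) (hk : ∀ i v, v i = k → f i v = 1) :
    ∃ q : ι → ℕ, ∀ i, ∃ T T' : Finset ι, f i (corner q T) = 0 ∧ f i (corner q T') = 1 := by
  have h := sum_cupCoboundaries h0 hk Finset.univ.toList (Finset.nodup_toList _)
  obtain ⟨q, -, hq⟩ := Finset.exists_ne_zero_of_sum_ne_zero (h.trans_ne one_ne_zero)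
  refine ⟨q, fun i => ?_⟩
  obtain ⟨T, -, T', -, hne⟩ := exists_ne_of_cupCoboundaries_ne_zero f q _ _ hq i (by simp)
  have key : ∀ x y : ZMod 2, x ≠ y → x = 0 ∧ y = 1 ∨ y = 0 ∧ x = 1 := by decide
  rcases key _ _ hne with h | h
  · exact ⟨T, T', h⟩
  · exact ⟨T', T, h⟩

end CubicalCochain

/-! ### A covering theorem for boxes -/

open CubicalCochain in
/-- An approximate form of `exists_mem_of_closed_cover`, from a labelling of the grid that
divides each edge of the box into `k` equal parts. -/
theorem exists_near_of_cover {ι : Type*} [Fintype ι] {a b : ι → ℝ} (hab : a ≤ b)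
    {A B : ι → Set (ι → ℝ)} (hcover : ∀ i, Icc a b ⊆ A i ∪ B i)
    (hA : ∀ i, ∀ s ∈ Icc a b, s i = a i → s ∈ A i)
    (hB : ∀ i, ∀ s ∈ Icc a b, s i = b i → s ∈ B i) {k : ℕ} (hk : 0 < k) :
    ∃ x ∈ Icc a b, ∀ i, (∃ y ∈ A i, dist y x ≤ dist b a / k) ∧
      ∃ y ∈ B i, dist y x ≤ dist b a / k := by
  classical
  have hk' : (0 : ℝ) < k := by exact_mod_cast hk
  -- lattice points outside the grid are first projected to the grid
  let pt : (ι → ℕ) → ι → ℝ := fun v i => a i + (b i - a i) * ((min (v i) k : ℕ) / k : ℝ)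
  have hfrac : ∀ m : ℕ, (0 : ℝ) ≤ (min m k : ℕ) / k ∧ ((min m k : ℕ) / k : ℝ) ≤ 1 := by
    intro m
    refine ⟨by positivity, (div_le_one hk').2 ?_⟩
    exact_mod_cast min_le_right m k
  have hpt : ∀ v, pt v ∈ Icc a b := by
    intro v
    constructor <;> intro i
    · have := mul_nonneg (sub_nonneg.2 (hab i)) (hfrac (v i)).1
      simp only [pt]; linarith
    · have := mul_le_mul_of_nonneg_left (hfrac (v i)).2 (sub_nonneg.2 (hab i))
      simp only [pt]; linarith
  -- the label `0` stands for `A i`; on the face `v i = k`, where `A i` may hold too, it is `1`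
  let f : ι → (ι → ℕ) → ZMod 2 := fun i v => if v i < k ∧ pt v ∈ A i then 0 else 1
  have h0 : ∀ i v, v i = 0 → f i v = 0 := by
    intro i v hv
    refine if_pos ⟨hv ▸ hk, hA i _ (hpt v) ?_⟩
    simp [pt, hv]
  have h1 : ∀ i v, v i = k → f i v = 1 := by
    intro i v hv
    exact if_neg fun h => h.1.ne hv
  obtain ⟨q, hq⟩ := exists_cube_all_labels h0 h1
  have hdist : ∀ T, dist (pt (corner q T)) (pt q) ≤ dist b a / k := by
    intro T
    refine (dist_pi_le_iff (by positivity)).2 fun i => ?_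
    have hstep : |((min (corner q T i) k : ℕ) : ℝ) - (min (q i) k : ℕ)| ≤ 1 := by
      have h1 : min (q i) k ≤ min (corner q T i) k := by
        simp only [corner]; split_ifs <;> omega
      have h2 : min (corner q T i) k ≤ min (q i) k + 1 := by
        simp only [corner]; split_ifs <;> omega
      have h1' : ((min (q i) k : ℕ) : ℝ) ≤ (min (corner q T i) k : ℕ) := by exact_mod_cast h1
      have h2' : ((min (corner q T i) k : ℕ) : ℝ) ≤ (min (q i) k : ℕ) + 1 := by
        exact_mod_cast h2
      rw [abs_le]
      constructor <;> linarith
    have hba : |b i - a i| ≤ dist b a := by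
      rw [← Real.dist_eq]; exact dist_le_pi_dist b a i
    calc dist (pt (corner q T) i) (pt q i)
        = |(b i - a i) * (((min (corner q T i) k : ℕ) : ℝ) - (min (q i) k : ℕ)) / k| := by
          rw [Real.dist_eq]
          congr 1
          simp only [pt]
          ring
      _ = |b i - a i| * |((min (corner q T i) k : ℕ) : ℝ) - (min (q i) k : ℕ)| / k := by
          rw [abs_div, abs_mul, abs_of_pos hk']
      _ ≤ dist b a * 1 / k := by gcongr
      _ = dist b a / k := by rw [mul_one]
  refine ⟨pt q, hpt q, fun i => ?_⟩
  obtain ⟨T, T', hT, hT'⟩ := hq i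
  refine ⟨⟨pt (corner q T), ?_, hdist T⟩, ⟨pt (corner q T'), ?_, hdist T'⟩⟩
  · by_contra h
    simp [f, h] at hT
  · rcases lt_or_ge (corner q T' i) k with h | h
    · refine (hcover i (hpt _)).resolve_left fun hmem => ?_
      simp [f, h, hmem] at hT'
    · refine hB i _ (hpt _) ?_
      simp only [pt, min_eq_right h, div_self hk'.ne']
      ring

/-- The covering form of the Poincaré–Miranda theorem: if for each `i` two closed sets cover a box,
and each contains one of the two faces orthogonal to the `i`-th axis, then all these sets have a
common point. -/
theorem exists_mem_of_closed_cover {ι : Type*} [Fintype ι] {a b : ι → ℝ} (hab : a ≤ b)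
    {A B : ι → Set (ι → ℝ)} (hAc : ∀ i, IsClosed (A i)) (hBc : ∀ i, IsClosed (B i))
    (hcover : ∀ i, Icc a b ⊆ A i ∪ B i)
    (hA : ∀ i, ∀ s ∈ Icc a b, s i = a i → s ∈ A i)
    (hB : ∀ i, ∀ s ∈ Icc a b, s i = b i → s ∈ B i) :
    ∃ x ∈ Icc a b, ∀ i, x ∈ A i ∧ x ∈ B i := by
  choose x hx hnear using fun k : ℕ => exists_near_of_cover hab hcover hA hB k.succ_pos
  obtain ⟨z, hz, φ, hφ, hlim⟩ := isCompact_Icc.tendsto_subseq hx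
  have hmesh : Filter.Tendsto (fun k : ℕ => dist b a / ((φ k).succ : ℝ)) Filter.atTop (nhds 0) := by
    have h := (tendsto_const_div_atTop_nhds_zero_nat (dist b a)).comp
      ((Filter.tendsto_add_atTop_nat 1).comp hφ.tendsto_atTop)
    exact h
  have hclosed : ∀ C : Set (ι → ℝ), IsClosed C →
      (∀ k : ℕ, ∃ y ∈ C, dist y (x k) ≤ dist b a / (k.succ : ℝ)) → z ∈ C := by
    intro C hC h
    choose y hy hyd using h
    refine hC.mem_of_tendsto (f := fun k => y (φ k)) (b := Filter.atTop) ?_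
      (Filter.Eventually.of_forall fun k => hy _)
    refine tendsto_of_tendsto_of_dist hlim ?_
    refine squeeze_zero (fun _ => dist_nonneg) (fun k => ?_) hmesh
    rw [dist_comm]
    exact hyd (φ k)
  exact ⟨z, hz, fun i => ⟨hclosed _ (hAc i) fun k => (hnear k i).1,
    hclosed _ (hBc i) fun k => (hnear k i).2⟩⟩

/-! ### Equilibria of games on a box -/

/-- The existence theorem of Nash, Debreu, Glicksberg and Fan for players with one-dimensional
strategy sets. -/
theorem exists_equilibrium_of_quasiconcaveOn {ι : Type*} [Fintype ι] [DecidableEq ι]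
    {a b : ι → ℝ} (hab : a ≤ b) {u : ι → (ι → ℝ) → ℝ}
    (hcont : ∀ i, ContinuousOn (u i) (Icc a b))
    (hconc : ∀ i, ∀ s ∈ Icc a b,
      QuasiconcaveOn ℝ (Icc (a i) (b i)) fun x => u i (Function.update s i x)) :
    ∃ s ∈ Icc a b, ∀ i, ∀ x ∈ Icc (a i) (b i), u i (Function.update s i x) ≤ u i s := by
  have hupd : ∀ i, ∀ s ∈ Icc a b, ∀ x ∈ Icc (a i) (b i), Function.update s i x ∈ Icc a b := by
    intro i s hs x hx
    exact ⟨le_update_iff.2 ⟨hx.1, fun j _ => hs.1 j⟩, update_le_iff.2 ⟨hx.2, fun j _ => hs.2 j⟩⟩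
  have hcu : ∀ i, ContinuousOn (fun p : (ι → ℝ) × ℝ => u i (Function.update p.1 i p.2))
      (Icc a b ×ˢ Icc (a i) (b i)) := fun i =>
    (hcont i).comp (continuous_fst.update i continuous_snd).continuousOn
      fun p hp => hupd i p.1 hp.1 p.2 hp.2
  -- the graph of the best response correspondence
  let R : ι → Set ((ι → ℝ) × ℝ) := fun i => {p | p ∈ Icc a b ×ˢ Icc (a i) (b i) ∧
    ∀ y ∈ Icc (a i) (b i), u i (Function.update p.1 i y) ≤ u i (Function.update p.1 i p.2)}
  have hR : ∀ i, IsCompact (R i) := by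
    intro i
    have hcomp : IsCompact (Icc a b ×ˢ Icc (a i) (b i)) := isCompact_Icc.prod isCompact_Icc
    refine hcomp.of_isClosed_subset ?_ fun p hp => hp.1
    have hEq : R i = (Icc a b ×ˢ Icc (a i) (b i)) ∩ ⋂ y ∈ Icc (a i) (b i),
        {p ∈ Icc a b ×ˢ Icc (a i) (b i) |
          u i (Function.update p.1 i y) ≤ u i (Function.update p.1 i p.2)} := by
      ext p
      simp only [R, mem_ofPred_eq, mem_inter_iff, mem_iInter]
      exact ⟨fun h => ⟨h.1, fun y hy => ⟨h.1, h.2 y hy⟩⟩, fun h => ⟨h.1, fun y hy => (h.2 y hy).2⟩⟩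
    rw [hEq]
    refine hcomp.isClosed.inter (isClosed_biInter fun y hy => ?_)
    refine hcomp.isClosed.isClosed_le ?_ (hcu i)
    exact (hcont i).comp (continuous_fst.update i continuous_const).continuousOn
      fun p hp => hupd i p.1 hp.1 y hy
  have hbest : ∀ i, ∀ s ∈ Icc a b, ∃ x, (s, x) ∈ R i := by
    intro i s hs
    obtain ⟨x, hx, hmax⟩ := (isCompact_Icc (a := a i) (b := b i)).exists_isMaxOn
      (nonempty_Icc.2 (hab i)) (f := fun x => u i (Function.update s i x))
      ((hcont i).comp (show Continuous fun x : ℝ => Function.update s i x from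
        continuous_const.update i continuous_id).continuousOn
        fun x hx => hupd i s hs x hx)
    exact ⟨x, ⟨hs, hx⟩, fun y hy => hmax hy⟩
  -- the profiles at which player `i` has a best response at or above, at or below its strategy
  obtain ⟨s, hs, hsR⟩ := exists_mem_of_closed_cover hab
    (A := fun i => Prod.fst '' (R i ∩ {p | p.1 i ≤ p.2}))
    (B := fun i => Prod.fst '' (R i ∩ {p | p.2 ≤ p.1 i}))
    (fun i => (((hR i).inter_right (isClosed_le (by fun_prop) (by fun_prop))).image
      continuous_fst).isClosed)
    (fun i => (((hR i).inter_right (isClosed_le (by fun_prop) (by fun_prop))).image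
      continuous_fst).isClosed)
    (by
      intro i s hs
      obtain ⟨x, hx⟩ := hbest i s hs
      exact (le_total (s i) x).imp (fun h => ⟨(s, x), ⟨hx, h⟩, rfl⟩)
        fun h => ⟨(s, x), ⟨hx, h⟩, rfl⟩)
    (by
      intro i s hs h
      obtain ⟨x, hx⟩ := hbest i s hs
      exact ⟨(s, x), ⟨hx, h.trans_le hx.1.2.1⟩, rfl⟩)
    (by
      intro i s hs h
      obtain ⟨x, hx⟩ := hbest i s hs
      exact ⟨(s, x), ⟨hx, hx.1.2.2.trans_eq h.symm⟩, rfl⟩)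
  refine ⟨s, hs, fun i x hx => ?_⟩
  obtain ⟨⟨⟨_, y⟩, ⟨hyR, hy⟩, rfl⟩, ⟨⟨s, z⟩, ⟨hzR, hz⟩, rfl⟩⟩ := hsR i
  -- the strategies at least as good as `x` form an interval that contains `y` and `z`, hence `s i`
  have h := ((hconc i s hs (u i (Function.update s i x))).ordConnected.out
    ⟨hzR.1.2, hzR.2 x hx⟩ ⟨hyR.1.2, hyR.2 x hx⟩ ⟨hz, hy⟩).2
  simpa using h

/-! ### Concavity of a product from its second derivative -/

theorem concaveOn_mul_of_deriv2_nonpos {g P : ℝ → ℝ} {a b : ℝ}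
    (hg : ContinuousOn g (Icc a b)) (hP : ContinuousOn P (Icc a b))
    (hg1 : ∀ x ∈ Ioo a b, DifferentiableAt ℝ g x)
    (hg2 : ∀ x ∈ Ioo a b, DifferentiableAt ℝ (deriv g) x)
    (hP1 : ∀ x ∈ Ioo a b, DifferentiableAt ℝ P x)
    (hP2 : ∀ x ∈ Ioo a b, DifferentiableAt ℝ (deriv P) x)
    (h : ∀ x ∈ Ioo a b,
      deriv (deriv g) x * P x + 2 * deriv g x * deriv P x + g x * deriv (deriv P) x ≤ 0) :
    ConcaveOn ℝ (Icc a b) fun x => g x * P x := by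
  have hd1 : ∀ x ∈ Ioo a b,
      HasDerivAt (fun x => g x * P x) (deriv g x * P x + g x * deriv P x) x := fun x hx =>
    (hg1 x hx).hasDerivAt.mul (hP1 x hx).hasDerivAt
  have hd2 : ∀ x ∈ Ioo a b, HasDerivAt (deriv fun x => g x * P x)
      (deriv (deriv g) x * P x + deriv g x * deriv P x +
        (deriv g x * deriv P x + g x * deriv (deriv P) x)) x := by
    intro x hx
    refine HasDerivAt.congr_of_eventuallyEq
      (f := fun x => deriv g x * P x + g x * deriv P x) ?_ ?_
    · exact ((hg2 x hx).hasDerivAt.mul (hP1 x hx).hasDerivAt).add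
        ((hg1 x hx).hasDerivAt.mul (hP2 x hx).hasDerivAt)
    · filter_upwards [isOpen_Ioo.mem_nhds hx] with y hy using (hd1 y hy).deriv
  refine concaveOn_of_deriv2_nonpos (convex_Icc a b) (hg.mul hP) ?_ ?_ ?_ <;> rw [interior_Icc]
  · exact fun x hx => (hd1 x hx).differentiableAt.differentiableWithinAt
  · exact fun x hx => (hd2 x hx).differentiableAt.differentiableWithinAt
  · intro x hx
    have := (hd2 x hx).deriv
    simp only [Function.iterate_succ, Function.iterate_zero, Function.comp_apply, id_eq]
    rw [this]
    linarith [h x hx]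

/-! ### The data contribution game -/

namespace DataContributionGame

variable {N : ℕ} {G : DataContributionGame N}

theorem profiles_eq_Icc (G : DataContributionGame N) : G.profiles = Icc 0 G.capacity := by
  ext s
  exact ⟨fun h => ⟨fun n => (h n).1, fun n => (h n).2⟩, fun h n => ⟨h.1 n, h.2 n⟩⟩

theorem update_mem_profiles {s : Fin N → ℝ} (hs : s ∈ G.profiles) {n : Fin N} {x : ℝ}
    (hx : x ∈ G.strategies n) : Function.update s n x ∈ G.profiles := by
  intro m
  rcases eq_or_ne m n with rfl | hm
  · simpa using hx
  · simpa [hm] using hs m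

theorem IsRegular.continuousOn_totalProfit (h : G.IsRegular) :
    ContinuousOn G.totalProfit G.profiles :=
  h.continuousOn_profit.comp h.continuousOn_acc (mapsTo_image _ _)

theorem IsRegular.continuousOn_payoff (h : G.IsRegular) (n : Fin N) :
    ContinuousOn (G.payoff n) G.profiles :=
  ((h.continuousOn_share n).mul h.continuousOn_totalProfit).sub
    ((h.continuousOn_privacyCost n).comp (continuous_apply n).continuousOn fun _ hs => hs n)

theorem SecondDerivativeCondition.allocatedProfitConcave {n : Fin N}
    (h : G.SecondDerivativeCondition n) (hreg : G.IsRegular) : G.AllocatedProfitConcave n := by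
  intro s hs
  have hline : ∀ F : (Fin N → ℝ) → ℝ, ContinuousOn F G.profiles →
      ContinuousOn (fun x => F (Function.update s n x)) (G.strategies n) := fun F hF =>
    hF.comp (show Continuous fun x : ℝ => Function.update s n x from
        continuous_const.update n continuous_id).continuousOn
      fun _ hx => update_mem_profiles hs hx
  have h := h s hs
  exact concaveOn_mul_of_deriv2_nonpos (hline _ (hreg.continuousOn_share n))
    (hline _ hreg.continuousOn_totalProfit) (fun x hx => (h x hx).1) (fun x hx => (h x hx).2.1)
    (fun x hx => (h x hx).2.2.1) (fun x hx => (h x hx).2.2.2.1) fun x hx => (h x hx).2.2.2.2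

theorem AllocatedProfitConcave.payoff_concaveOn {n : Fin N} (h : G.AllocatedProfitConcave n)
    (hcost : G.PrivacyCostConvexIncreasing) {s : Fin N → ℝ} (hs : s ∈ G.profiles) :
    ConcaveOn ℝ (G.strategies n) fun x => G.payoff n (Function.update s n x) := by
  have := (h s hs).sub (hcost n).1
  refine this.congr fun x _ => ?_
  simp [payoff]

end DataContributionGame

theorem theorem1 {N : ℕ} (G : DataContributionGame N)
    (hreg : G.IsRegular)
    (hacc : G.AccuracyConcaveIncreasing)
    (hprofit : ∀ n, G.AllocatedProfitConcave n ∨ G.SecondDerivativeCondition n)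
    (hcost : G.PrivacyCostConvexIncreasing) :
    ∃ s : Fin N → ℝ, G.IsNashEquilibrium s := by
  have hconc : ∀ n, G.AllocatedProfitConcave n := fun n =>
    (hprofit n).elim id fun h => h.allocatedProfitConcave hreg
  obtain ⟨s, hs, hmax⟩ := exists_equilibrium_of_quasiconcaveOn (u := G.payoff)
    G.capacity_nonneg (fun n => G.profiles_eq_Icc ▸ hreg.continuousOn_payoff n)
    fun n s hs => ((hconc n).payoff_concaveOn hcost (G.profiles_eq_Icc.symm ▸ hs)).quasiconcaveOn
  exact ⟨s, G.profiles_eq_Icc.symm ▸ hs, hmax⟩
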